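/- Let $k\ge 1$ and $[k]=\{1,\dots,k\}$. A $[k]$-graphon is a symmetric measurable function $W$ from $[0,1]^2$ to the set of probability measures on $[k]$; write $W_i(x,y):=W(x,y)(\{i\})$ for $i\in[k]$. For $[k]$-graphons $U,W$ let $$d_{k\square}(U,W):=\sup_{S,T\subseteq[0,1]}\ \sum_{i=1}^k\left|\int_{S\times T}\bigl(U_i(x,y)-W_i(x,y)\bigr)\,dx\,dy\right|,$$ where the supremum is over all pairs of Lebesgue-measurable (equivalently, Borel) sets $S,T$, and let $$\delta_{k\square}(U,W):=\inf_{\varphi}\ d_{k\square}(U,W^\varphi),\qquad W^\varphi(x,y):=W(\varphi(x),\varphi(y)),$$ where the infimum is over all (not necessarily invertible) measure-preserving maps $\varphi:[0,1]\to[0,1]$. **Theorem.** Let $\mathcal W_k$ be the set of all $[k]$-graphons. The relation $\delta_{k\square}(U,W)=0$ is an equivalence relation on $\mathcal W_k$, $\delta_{k\square}$ induces a metric on the quotient $\widetilde{\mathcal W_k}$ of $\mathcal W_k$ by this relation, and the metric space $(\widetilde{\mathcal W_k},\delta_{k\square})$ is compact. -/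

import Mathlib

open MeasureTheory unitInterval

/-- A `[k]`-graphon: a symmetric measurable function from `[0,1]²` to the space of probability
measures on the finite set of `k` colours (with the σ-algebra generated by the evaluation maps,
which for a finite set of colours is the Borel σ-algebra). -/
structure DecoratedGraphon (k : ℕ) where
  toFun : I × I → ProbabilityMeasure (Fin k)
  measurable_toFun : Measurable fun z => (toFun z : Measure (Fin k))
  symm : ∀ x y : I, toFun (x, y) = toFun (y, x)

namespace DecoratedGraphon

variable {k : ℕ}

/-- `W.prob i (x, y)` is the probability of the colour `i` under the measure `W(x, y)`. -/
noncomputable def prob (W : DecoratedGraphon k) (i : Fin k) (z : I × I) : ℝ :=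
  (W.toFun z : Measure (Fin k)).real {i}

/-- The pull-back `W^φ(x, y) = W(φ(x), φ(y))` along a measure-preserving map `φ`
(which need not be invertible). -/
def pullback (W : DecoratedGraphon k) (φ : I → I) (hφ : MeasurePreserving φ volume volume) :
    DecoratedGraphon k where
  toFun z := W.toFun (φ z.1, φ z.2)
  measurable_toFun := W.measurable_toFun.comp
    ((hφ.measurable.comp measurable_fst).prodMk (hφ.measurable.comp measurable_snd))
  symm x y := W.symm (φ x) (φ y)

/-- The labelled cut distance: the supremum over measurable `S, T ⊆ [0,1]` of
`∑ i, |∫_{S × T} (U_i - W_i)|`. -/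
noncomputable def cutDist (U W : DecoratedGraphon k) : ℝ :=
  ⨆ p : {S : Set I // MeasurableSet S} × {T : Set I // MeasurableSet T},
    ∑ i : Fin k, |∫ z in (p.1 : Set I) ×ˢ (p.2 : Set I), (U.prob i z - W.prob i z)|

/-- The (unlabelled) cut distance: the infimum of the labelled cut distances between `U` and
`W^φ`, over all measure-preserving maps `φ : [0,1] → [0,1]`. -/
noncomputable def cutDelta (U W : DecoratedGraphon k) : ℝ :=
  ⨅ φ : {φ : I → I // MeasurePreserving φ volume volume}, cutDist U (W.pullback φ.1 φ.2)

/-- `U` and `W` are identified when their cut distance is zero. -/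
def CutEquiv (U W : DecoratedGraphon k) : Prop :=
  cutDelta U W = 0

end DecoratedGraphon

/-! Pulling back along a measure-preserving map never increases `cutDist` (`IsCutBound.comp`), which
gives the triangle inequality for `cutDelta`. Symmetry needs `cutDelta W (W^φ) = 0` although `φ` may
have no inverse; approximate right inverses suffice, and they come from matching finite labellings
of the interval with equal distributions.

Compactness is total boundedness plus completeness. Weak regularity approximates every graphon by a
step function whose matrix comes from a finite list and whose number of classes depends only on `k`
and `ε`. Up to rearrangement such a function is determined by its matrix and class sizes, so
rounding the sizes leaves finitely many codes (`exists_finite_discretization`). For completeness, a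
fast Cauchy sequence is aligned into one that is Cauchy for `cutDist`. The weak `L²` limit of its
colour probabilities is again a graphon, and cut bounds survive the limit because each tests one
fixed rectangle (`exists_cutDist_le_of_cauchy`). -/

/-! ### Cut norm bounds and their behaviour under pull-back. -/

/-- `ε` bounds the (decorated) cut norm of the family `F`. -/
def IsCutBound {ι : Type*} [Fintype ι] (F : ι → I × I → ℝ) (ε : ℝ) : Prop :=
  ∀ S T : Set I, MeasurableSet S → MeasurableSet T → ∑ i, |∫ z in S ×ˢ T, F i z| ≤ ε

namespace IsCutBound

variable {ι : Type*} [Fintype ι] {F G : ι → I × I → ℝ} {a b : ℝ}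

lemma nonneg (h : IsCutBound F a) : 0 ≤ a :=
  (Finset.sum_nonneg fun _ _ => abs_nonneg _).trans (h ∅ ∅ .empty .empty)

lemma neg (h : IsCutBound F a) : IsCutBound (fun i z => -F i z) a := by
  intro S T hS hT
  simpa [integral_neg, abs_neg] using h S T hS hT

lemma add (hF : ∀ i, Integrable (F i)) (hG : ∀ i, Integrable (G i))
    (h : IsCutBound F a) (h' : IsCutBound G b) : IsCutBound (fun i z => F i z + G i z) (a + b) := by
  intro S T hS hT
  refine le_trans ?_ (add_le_add (h S T hS hT) (h' S T hS hT))
  rw [← Finset.sum_add_distrib]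
  gcongr with i
  rw [integral_add (hF i).integrableOn (hG i).integrableOn]
  exact abs_add_le _ _

lemma of_integral_abs_le (hF : ∀ i, Integrable (F i)) (h : ∑ i, ∫ z, |F i z| ≤ a) :
    IsCutBound F a := by
  intro S T hS hT
  refine le_trans (Finset.sum_le_sum fun i _ => ?_) h
  calc |∫ z in S ×ˢ T, F i z| ≤ ∫ z in S ×ˢ T, |F i z| := abs_integral_le_integral_abs
    _ ≤ ∫ z, |F i z| := setIntegral_le_integral (hF i).abs (.of_forall fun _ => abs_nonneg _)

end IsCutBound

lemma integral_le_setIntegral_nonneg_of_le {α : Type*} [MeasurableSpace α] {ν μ : Measure α}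
    (hνμ : ν ≤ μ) {g : α → ℝ} (hm : Measurable g) (hg : Integrable g μ) :
    ∫ x, g x ∂ν ≤ ∫ x in {x | 0 ≤ g x}, g x ∂μ := by
  have hs : MeasurableSet {x | 0 ≤ g x} := measurableSet_le measurable_const hm
  have h0 : ∀ x, 0 ≤ {x | 0 ≤ g x}.indicator g x := fun x => by
    by_cases hx : 0 ≤ g x <;> simp [Set.indicator, hx]
  calc ∫ x, g x ∂ν ≤ ∫ x, {x | 0 ≤ g x}.indicator g x ∂ν := by
        refine integral_mono (hg.mono_measure hνμ) ((hg.indicator hs).mono_measure hνμ) fun x => ?_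
        by_cases hx : 0 ≤ g x
        · simp [Set.indicator, hx]
        · simpa [Set.indicator, hx] using (not_le.1 hx).le
    _ ≤ ∫ x, {x | 0 ≤ g x}.indicator g x ∂μ :=
        integral_mono_measure hνμ (.of_forall h0) (hg.indicator hs)
    _ = _ := integral_indicator hs

/-- The integral is linear in each measure separately, so with `ν₂` fixed it only grows when `ν₁` is
replaced by Lebesgue measure on the set where the inner integral is nonnegative; the same is then
done to `ν₂`. -/
lemma integral_prod_le_setIntegral_prod {ν₁ ν₂ : Measure I} (h₁ : ν₁ ≤ volume) (h₂ : ν₂ ≤ volume)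
    {G : I × I → ℝ} (hm : Measurable G) {C : ℝ} (hC : ∀ z, |G z| ≤ C) :
    ∃ S T : Set I, MeasurableSet S ∧ MeasurableSet T ∧
      ∫ z, G z ∂(ν₁.prod ν₂) ≤ ∫ z in S ×ˢ T, G z := by
  have : IsFiniteMeasure ν₁ := ⟨(h₁ _).trans_lt (measure_lt_top _ _)⟩
  have : IsFiniteMeasure ν₂ := ⟨(h₂ _).trans_lt (measure_lt_top _ _)⟩
  have hint : ∀ (α β : Measure I) [IsFiniteMeasure α] [IsFiniteMeasure β],
      Integrable G (α.prod β) := fun α β _ _ =>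
    Integrable.of_bound hm.aestronglyMeasurable C (.of_forall hC)
  let g : I → ℝ := fun x => ∫ y, G (x, y) ∂ν₂
  have hg : Measurable g := (hm.stronglyMeasurable.integral_prod_right' (ν := ν₂)).measurable
  let S : Set I := {x | 0 ≤ g x}
  let f : I → ℝ := fun y => ∫ x in S, G (x, y)
  have hf : Measurable f :=
    (hm.stronglyMeasurable.integral_prod_left' (μ := volume.restrict S)).measurable
  let T : Set I := {y | 0 ≤ f y}
  refine ⟨S, T, measurableSet_le measurable_const hg, measurableSet_le measurable_const hf, ?_⟩
  calc ∫ z, G z ∂(ν₁.prod ν₂) = ∫ x, g x ∂ν₁ := integral_prod _ (hint _ _)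
    _ ≤ ∫ x in S, g x := integral_le_setIntegral_nonneg_of_le h₁ hg (hint _ _).integral_prod_left
    _ = ∫ y, f y ∂ν₂ := integral_integral_swap (hint (volume.restrict S) ν₂)
    _ ≤ ∫ y in T, f y := integral_le_setIntegral_nonneg_of_le h₂ hf (hint _ _).integral_prod_right
    _ = ∫ z in S ×ˢ T, G z := by
      rw [Measure.volume_eq_prod, ← Measure.prod_restrict, integral_prod_symm _ (hint _ _)]

lemma MeasureTheory.MeasurePreserving.prodMap_unitInterval {φ : I → I} (hφ : MeasurePreserving φ) :
    MeasurePreserving (fun z : I × I => (φ z.1, φ z.2)) := hφ.prod hφ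

lemma map_restrict_le {φ : I → I} (hφ : MeasurePreserving φ) (S : Set I) :
    (volume.restrict S).map φ ≤ volume := by
  conv_rhs => rw [← hφ.map_eq]
  exact Measure.map_mono Measure.restrict_le_self hφ.measurable

/-- For non-injective `φ`, the image of Lebesgue measure on `S` is merely dominated by Lebesgue
measure and need not be its restriction to a set. `integral_prod_le_setIntegral_prod` turns these
dominated measures back into sets. -/
lemma IsCutBound.comp {ι : Type*} [Fintype ι] {F : ι → I × I → ℝ} {a C : ℝ}
    (hm : ∀ i, Measurable (F i)) (hC : ∀ i z, |F i z| ≤ C) (h : IsCutBound F a)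
    {φ : I → I} (hφ : MeasurePreserving φ) :
    IsCutBound (fun i z => F i (φ z.1, φ z.2)) a := by
  intro S T hS hT
  have hint : ∀ i, Integrable (F i) := fun i =>
    Integrable.of_bound (hm i).aestronglyMeasurable C (.of_forall (hC i))
  have hint' : ∀ i, Integrable (fun z : I × I => F i (φ z.1, φ z.2)) := fun i =>
    hφ.prodMap_unitInterval.integrable_comp_of_integrable (hint i)
  have hsgn : ∀ x : ℝ, |x| = (SignType.sign x : ℝ) * x := fun x => (sign_mul_self x).symm
  -- Fixing the signs turns the sum of absolute values into the integral of a single function `G`.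
  set c : ι → ℝ := fun i => (SignType.sign (∫ z in S ×ˢ T, F i (φ z.1, φ z.2)) : ℝ) with hc
  have hc1 : ∀ i, |c i| ≤ 1 := fun i => by
    simp only [hc]
    rcases SignType.sign (∫ z in S ×ˢ T, F i (φ z.1, φ z.2)) <;> simp
  let G : I × I → ℝ := fun z => ∑ i, c i * F i z
  have hG : Measurable G := Finset.measurable_fun_sum _ fun i _ => (hm i).const_mul _
  have hGC : ∀ z, |G z| ≤ ∑ _i : ι, C := fun z => by
    refine (Finset.abs_sum_le_sum_abs _ _).trans (Finset.sum_le_sum fun i _ => ?_)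
    rw [abs_mul]
    exact (mul_le_of_le_one_left (abs_nonneg _) (hc1 i)).trans (hC i z)
  obtain ⟨S', T', hS', hT', hle⟩ := integral_prod_le_setIntegral_prod (map_restrict_le hφ S)
    (map_restrict_le hφ T) hG hGC
  calc ∑ i, |∫ z in S ×ˢ T, F i (φ z.1, φ z.2)|
      = ∫ z in S ×ˢ T, G (φ z.1, φ z.2) := by
        rw [integral_finsetSum _ fun i _ => ((hint' i).const_mul _).integrableOn]
        exact Finset.sum_congr rfl fun i _ => by rw [integral_const_mul, hsgn]
    _ = ∫ z, G z ∂(((volume.restrict S).map φ).prod ((volume.restrict T).map φ)) := by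
        rw [Measure.map_prod_map _ _ hφ.measurable hφ.measurable, Measure.prod_restrict,
          ← Measure.volume_eq_prod, integral_map (hφ.measurable.prodMap hφ.measurable).aemeasurable hG.aestronglyMeasurable]
        rfl
    _ ≤ ∫ z in S' ×ˢ T', G z := hle
    _ = ∑ i, c i * ∫ z in S' ×ˢ T', F i z := by
        rw [integral_finsetSum _ fun i _ => ((hint i).const_mul _).integrableOn]
        exact Finset.sum_congr rfl fun i _ => integral_const_mul _ _
    _ ≤ ∑ i, |∫ z in S' ×ˢ T', F i z| := Finset.sum_le_sum fun i _ => by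
        refine (le_abs_self _).trans ?_
        rw [abs_mul]
        exact mul_le_of_le_one_left (abs_nonneg _) (hc1 i)
    _ ≤ a := h S' T' hS' hT'

/-! ### Labelled and unlabelled cut distances. -/

namespace DecoratedGraphon

variable {k : ℕ}

lemma prob_nonneg (W : DecoratedGraphon k) (i : Fin k) (z : I × I) : 0 ≤ W.prob i z :=
  measureReal_nonneg

lemma prob_le_one (W : DecoratedGraphon k) (i : Fin k) (z : I × I) : W.prob i z ≤ 1 :=
  measureReal_le_one

lemma abs_prob_le_one (W : DecoratedGraphon k) (i : Fin k) (z : I × I) : |W.prob i z| ≤ 1 := by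
  rw [abs_of_nonneg (W.prob_nonneg i z)]
  exact W.prob_le_one i z

lemma sum_prob (W : DecoratedGraphon k) (z : I × I) : ∑ i, W.prob i z = 1 := by
  unfold prob
  rw [sum_measureReal_singleton]
  simp

lemma prob_swap (W : DecoratedGraphon k) (i : Fin k) (x y : I) :
    W.prob i (x, y) = W.prob i (y, x) := by
  simp only [prob, W.symm x y]

lemma measurable_prob (W : DecoratedGraphon k) (i : Fin k) : Measurable (W.prob i) :=
  ((Measure.measurable_coe (MeasurableSet.singleton i)).comp W.measurable_toFun).ennreal_toReal

lemma integrable_prob (W : DecoratedGraphon k) (i : Fin k) : Integrable (W.prob i) :=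
  Integrable.of_bound (W.measurable_prob i).aestronglyMeasurable 1 (.of_forall (W.abs_prob_le_one i))

lemma abs_prob_sub_prob_le_one (U W : DecoratedGraphon k) (i : Fin k) (z : I × I) :
    |U.prob i z - W.prob i z| ≤ 1 := by
  rw [abs_le]
  constructor <;>
  linarith [U.prob_nonneg i z, U.prob_le_one i z, W.prob_nonneg i z, W.prob_le_one i z]

lemma bddAbove_cutDist (U W : DecoratedGraphon k) :
    BddAbove (Set.range fun p : {S : Set I // MeasurableSet S} × {T : Set I // MeasurableSet T} =>
      ∑ i : Fin k, |∫ z in (p.1 : Set I) ×ˢ (p.2 : Set I), (U.prob i z - W.prob i z)|) := by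
  refine ⟨∑ i, ∫ z, |U.prob i z - W.prob i z|, ?_⟩
  rintro _ ⟨p, rfl⟩
  exact IsCutBound.of_integral_abs_le (fun i => (U.integrable_prob i).sub (W.integrable_prob i))
    le_rfl p.1 p.2 p.1.2 p.2.2

lemma cutDist_le_iff {U W : DecoratedGraphon k} {a : ℝ} :
    cutDist U W ≤ a ↔ IsCutBound (fun i z => U.prob i z - W.prob i z) a := by
  have : Nonempty {S : Set I // MeasurableSet S} := ⟨⟨∅, .empty⟩⟩
  rw [cutDist, ciSup_le_iff (bddAbove_cutDist U W)]
  exact ⟨fun h S T hS hT => h (⟨S, hS⟩, ⟨T, hT⟩), fun h p => h _ _ p.1.2 p.2.2⟩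

lemma isCutBound_cutDist (U W : DecoratedGraphon k) :
    IsCutBound (fun i z => U.prob i z - W.prob i z) (cutDist U W) :=
  cutDist_le_iff.1 le_rfl

lemma cutDist_nonneg (U W : DecoratedGraphon k) : 0 ≤ cutDist U W :=
  (isCutBound_cutDist U W).nonneg

lemma cutDist_self (U : DecoratedGraphon k) : cutDist U U = 0 :=
  le_antisymm (cutDist_le_iff.2 fun S T _ _ => by simp) (cutDist_nonneg U U)

lemma cutDist_comm (U W : DecoratedGraphon k) : cutDist U W = cutDist W U := by
  have h : ∀ U W : DecoratedGraphon k, cutDist U W ≤ cutDist W U := fun U W =>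
    cutDist_le_iff.2 (by simpa using (isCutBound_cutDist W U).neg)
  exact le_antisymm (h U W) (h W U)

lemma cutDist_triangle (U V W : DecoratedGraphon k) :
    cutDist U W ≤ cutDist U V + cutDist V W := by
  refine cutDist_le_iff.2 ?_
  simpa using (isCutBound_cutDist U V).add
    (fun i => (U.integrable_prob i).sub (V.integrable_prob i))
    (fun i => (V.integrable_prob i).sub (W.integrable_prob i)) (isCutBound_cutDist V W)

lemma cutDist_pullback_le (U W : DecoratedGraphon k) {φ : I → I}
    (hφ : MeasurePreserving φ volume volume) :
    cutDist (U.pullback φ hφ) (W.pullback φ hφ) ≤ cutDist U W :=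
  cutDist_le_iff.2 <| (isCutBound_cutDist U W).comp
    (fun i => (U.measurable_prob i).sub (W.measurable_prob i))
    (fun i z => abs_prob_sub_prob_le_one U W i z) hφ

lemma bddBelow_cutDelta (U W : DecoratedGraphon k) :
    BddBelow (Set.range fun φ : {φ : I → I // MeasurePreserving φ volume volume} =>
      cutDist U (W.pullback φ.1 φ.2)) :=
  ⟨0, by rintro _ ⟨φ, rfl⟩; exact cutDist_nonneg _ _⟩

lemma cutDelta_le_cutDist_pullback (U W : DecoratedGraphon k) {φ : I → I}
    (hφ : MeasurePreserving φ volume volume) : cutDelta U W ≤ cutDist U (W.pullback φ hφ) :=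
  ciInf_le (bddBelow_cutDelta U W) ⟨φ, hφ⟩

lemma cutDelta_le_cutDist (U W : DecoratedGraphon k) : cutDelta U W ≤ cutDist U W :=
  cutDelta_le_cutDist_pullback U W (MeasurePreserving.id volume)

lemma exists_cutDist_pullback_lt {U W : DecoratedGraphon k} {a : ℝ} (h : cutDelta U W < a) :
    ∃ (φ : I → I) (hφ : MeasurePreserving φ volume volume), cutDist U (W.pullback φ hφ) < a := by
  have : Nonempty {φ : I → I // MeasurePreserving φ volume volume} :=
    ⟨⟨id, MeasurePreserving.id volume⟩⟩
  obtain ⟨φ, h⟩ := exists_lt_of_ciInf_lt h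
  exact ⟨φ.1, φ.2, h⟩

lemma cutDelta_nonneg (U W : DecoratedGraphon k) : 0 ≤ cutDelta U W :=
  Real.iInf_nonneg fun _ => cutDist_nonneg _ _

lemma cutDelta_self (U : DecoratedGraphon k) : cutDelta U U = 0 :=
  le_antisymm ((cutDelta_le_cutDist U U).trans_eq (cutDist_self U)) (cutDelta_nonneg U U)

/-- If `V^φ` is near `U` and `W^ψ` is near `V`, then `W^(ψ ∘ φ)` is near `V^φ`, as pulling back by
`φ` does not increase `cutDist`. -/
lemma cutDelta_triangle (U V W : DecoratedGraphon k) :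
    cutDelta U W ≤ cutDelta U V + cutDelta V W := by
  refine le_of_forall_pos_le_add fun ε hε => ?_
  obtain ⟨φ, hφ, h₁⟩ := exists_cutDist_pullback_lt (lt_add_of_pos_right (cutDelta U V) (half_pos hε))
  obtain ⟨ψ, hψ, h₂⟩ := exists_cutDist_pullback_lt (lt_add_of_pos_right (cutDelta V W) (half_pos hε))
  have h₃ := cutDist_pullback_le V (W.pullback ψ hψ) hφ
  have h₄ := cutDist_triangle U (V.pullback φ hφ) ((W.pullback ψ hψ).pullback φ hφ)
  have h₅ : cutDelta U W ≤ cutDist U ((W.pullback ψ hψ).pullback φ hφ) :=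
    cutDelta_le_cutDist_pullback U W (hψ.comp hφ)
  linarith

end DecoratedGraphon

/-! ### Measure-preserving maps and symmetry of `cutDelta`. -/

/-- The distribution function of an atomless probability measure on `[0,1]` is uniform. -/
lemma exists_map_eq_volume_of_nullSingletonClass (ν : Measure I) [IsProbabilityMeasure ν] [NullSingletonClass ν] :
    ∃ h : I → I, Measurable h ∧ ν.map h = volume := by
  have : IsProbabilityMeasure (ν.map (Subtype.val : I → ℝ)) :=
    Measure.isProbabilityMeasure_map (by fun_prop)
  set F := ProbabilityTheory.cdf (ν.map (Subtype.val : I → ℝ)) with hF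
  have hFr : ∀ x : I, F x = ν.real (Set.Iic x) := fun x => by
    rw [ProbabilityTheory.cdf_eq_real, map_measureReal_apply (by fun_prop) measurableSet_Iic]
    rfl
  have hcont : Continuous F := by
    refine continuous_iff_continuousAt.2 fun x => ?_
    rw [F.mono.continuousAt_iff_leftLim_eq_rightLim, F.rightLim_eq]
    have h1 := F.measure_singleton x
    rw [hF, ProbabilityTheory.measure_cdf, ← hF, Measure.map_apply (by fun_prop)
      (measurableSet_singleton x)] at h1
    have h2 : ν ((Subtype.val : I → ℝ) ⁻¹' {x}) = 0 :=
      Set.Subsingleton.measure_zero (fun a ha b hb => Subtype.ext (by simp_all)) _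
    rw [h2] at h1
    have h3 := ENNReal.ofReal_eq_zero.1 h1.symm
    linarith [F.mono.leftLim_le (le_refl x)]
  have hmem : ∀ x : I, F x ∈ Set.Icc (0 : ℝ) 1 := fun x => by
    rw [hFr]; exact ⟨measureReal_nonneg, measureReal_le_one⟩
  let G : I → I := fun x => ⟨F x, hmem x⟩
  have hG : Continuous G := by fun_prop
  have hGmono : Monotone G := fun x y hxy => F.mono hxy
  have hG0 : G 0 = 0 := by
    apply Subtype.ext
    change F (0 : I) = 0
    rw [hFr]
    have : Set.Iic (0 : I) = {0} := by ext x; simp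
    simp [this, measureReal_def]
  have hG1 : G 1 = 1 := by
    apply Subtype.ext
    change F (1 : I) = 1
    rw [hFr]
    have : Set.Iic (1 : I) = Set.univ := Set.eq_univ_of_forall fun x => (x.2.2 : x ≤ 1)
    simp [this]
  refine ⟨G, hG.measurable, ?_⟩
  have : IsProbabilityMeasure (ν.map G) := Measure.isProbabilityMeasure_map hG.aemeasurable
  refine Measure.ext_of_Iic _ _ fun t => ?_
  rw [Measure.map_apply hG.measurable measurableSet_Iic, unitInterval.volume_Iic]
  -- The last point `x` with `G x ≤ t` satisfies `G x = t` by the intermediate value theorem, so the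
  -- preimage of `Iic t` is `Iic x`, of mass `t`.
  obtain ⟨x, hx, hmax⟩ := ((isClosed_Iic (a := t)).preimage hG).isCompact.exists_isGreatest
    ⟨0, by simp [hG0]⟩
  have hset : G ⁻¹' Set.Iic t = Set.Iic x :=
    Set.Subset.antisymm (fun y hy => hmax hy) fun y hy => (hGmono hy).trans hx
  obtain ⟨y, -, hy⟩ := intermediate_value_Icc (zero_le_one' I) hG.continuousOn
    (show t ∈ Set.Icc (G 0) (G 1) by rw [hG0, hG1]; exact ⟨t.2.1, t.2.2⟩)
  have hGx : G x = t := le_antisymm hx (hy ▸ hGmono (hmax (show G y ≤ t from hy.le)))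
  rw [hset, ← ofReal_measureReal, ← hFr]
  exact congrArg (fun s : I => ENNReal.ofReal s) hGx

/-- Two finite labellings of `[0,1]` with the same distribution are related by a
measure-preserving map. -/
lemma exists_measurePreserving_comp_ae_eq {L : Type*} [Fintype L] [MeasurableSpace L]
    [MeasurableSingletonClass L] {c c' : I → L} (hc : Measurable c) (hc' : Measurable c')
    (h : ∀ l, volume (c ⁻¹' {l}) = volume (c' ⁻¹' {l})) :
    ∃ φ : I → I, MeasurePreserving φ volume volume ∧ ∀ᵐ x, c' (φ x) = c x := by
  classical
  have hms : ∀ l, MeasurableSet (c ⁻¹' {l}) := fun l => hc (measurableSet_singleton l)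
  have hms' : ∀ l, MeasurableSet (c' ⁻¹' {l}) := fun l => hc' (measurableSet_singleton l)
  -- Class by class: flatten the normalised measure on the class of `c` to Lebesgue measure, then
  -- map that onto the normalised measure on the class of `c'`. On null classes any map works.
  have key : ∀ l, ∃ g : I → I, Measurable g ∧
      (volume.restrict (c ⁻¹' {l})).map g = volume.restrict (c' ⁻¹' {l}) := fun l => by
    by_cases h0 : volume (c ⁻¹' {l}) = 0
    · refine ⟨id, measurable_id, ?_⟩
      rw [Measure.restrict_eq_zero.2 h0, Measure.restrict_eq_zero.2 (h l ▸ h0), Measure.map_zero]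
    · have h0' : volume (c' ⁻¹' {l}) ≠ 0 := h l ▸ h0
      have := ProbabilityTheory.cond_isProbabilityMeasure h0
      have := ProbabilityTheory.cond_isProbabilityMeasure h0'
      have : NullSingletonClass (ProbabilityTheory.cond volume (c ⁻¹' {l})) :=
        ⟨fun x => ProbabilityTheory.cond_absolutelyContinuous (measure_singleton x)⟩
      obtain ⟨u, hu, hu'⟩ :=
        exists_map_eq_volume_of_nullSingletonClass (ProbabilityTheory.cond volume (c ⁻¹' {l}))
      obtain ⟨v, hv, hv'⟩ := (ProbabilityTheory.cond volume (c' ⁻¹' {l})).exists_measurable_map_eq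
      refine ⟨v ∘ u, hv.comp hu, ?_⟩
      have e : (ProbabilityTheory.cond volume (c ⁻¹' {l})).map (v ∘ u)
          = ProbabilityTheory.cond volume (c' ⁻¹' {l}) := by
        rw [← Measure.map_map hv hu, hu', hv']
      rw [ProbabilityTheory.cond, ProbabilityTheory.cond, Measure.map_smul, h l] at e
      have e' := congrArg (fun m => volume (c' ⁻¹' {l}) • m) e
      simpa [smul_smul, ENNReal.mul_inv_cancel h0' (measure_ne_top _ _)] using e'
  choose g hg hgm using key
  let φ : I → I := fun x => g (c x) x
  have hφ : Measurable φ := by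
    have : Measurable (fun p : L × I => g p.1 p.2) := measurable_from_prod_countable_right hg
    exact this.comp (hc.prodMk measurable_id)
  have hres : ∀ l, (volume.restrict (c ⁻¹' {l})).map φ = volume.restrict (c' ⁻¹' {l}) := fun l => by
    rw [← hgm l]
    refine Measure.map_congr ?_
    filter_upwards [ae_restrict_mem (hms l)] with x hx
    simp only [Set.mem_preimage, Set.mem_singleton_iff] at hx
    simp [φ, hx]
  have hsum : ∀ {d : I → L}, Measurable d →
      (volume : Measure I) = Measure.sum fun l => volume.restrict (d ⁻¹' {l}) := fun {d} hd => by
    rw [← Measure.restrict_iUnion (fun a b hab => ?_) fun l => hd (measurableSet_singleton l)]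
    · rw [← Set.preimage_iUnion, Set.iUnion_of_singleton, Set.preimage_univ, Measure.restrict_univ]
    · exact Disjoint.preimage d (Set.disjoint_singleton.2 hab)
  refine ⟨φ, ⟨hφ, ?_⟩, ?_⟩
  · conv_lhs => rw [hsum hc]
    rw [Measure.map_sum hφ.aemeasurable]
    simp_rw [hres]
    exact (hsum hc').symm
  · rw [hsum hc, Measure.ae_sum_iff]
    intro l
    have h1 : ∀ᵐ y ∂((volume.restrict (c ⁻¹' {l})).map φ), c' y = l := by
      rw [hres]
      exact ae_restrict_mem (hms' l)
    filter_upwards [ae_of_ae_map hφ.aemeasurable h1, ae_restrict_mem (hms l)] with x hx hx'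
    rw [hx]
    exact hx'.symm

/-- A measure-preserving map has approximate right inverses, with respect to the `L¹` distance
between an integrable function and its pull-back. -/
lemma exists_measurePreserving_integral_norm_sub_pullback_le {E : Type*} [NormedAddCommGroup E]
    [NormedSpace ℝ E] {f : I × I → E} (hf : Integrable f) {φ : I → I}
    (hφ : MeasurePreserving φ volume volume) {ε : ℝ} (hε : 0 < ε) :
    ∃ ψ : I → I, MeasurePreserving ψ volume volume ∧
      ∫ z, ‖f z - f (φ (ψ z.1), φ (ψ z.2))‖ ≤ ε := by
  obtain ⟨g, hg, hgi⟩ := hf.exists_boundedContinuous_integral_sub_le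
    (show 0 < ε / 3 by positivity)
  obtain ⟨δ, hδ, hgδ⟩ := Metric.uniformContinuous_iff.1
    (CompactSpace.uniformContinuous_of_continuous g.continuous) (ε / 3) (by positivity)
  obtain ⟨N, hN⟩ := exists_nat_one_div_lt hδ
  -- Cells of length `1 / (N + 1) < δ`. The point `1` has floor `N + 1`, hence `N + 2` labels and no
  -- wrap-around in `Fin.ofNat`.
  let c : I → Fin (N + 2) := fun x => Fin.ofNat (N + 2) ⌊((N : ℝ) + 1) * (x : ℝ)⌋₊
  have hc : Measurable c :=
    (measurable_from_top (f := Fin.ofNat (N + 2))).comp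
      (Nat.measurable_floor.comp (measurable_subtype_coe.const_mul _))
  have hcd : ∀ x y, c x = c y → dist x y < δ := fun x y hxy => by
    have hlt : ∀ x : I, ⌊((N : ℝ) + 1) * (x : ℝ)⌋₊ < N + 2 := fun x => by
      rw [Nat.floor_lt (by have := x.2.1; positivity)]
      push_cast
      nlinarith [x.2.2, (Nat.cast_nonneg N : (0 : ℝ) ≤ N)]
    have h1 : ⌊((N : ℝ) + 1) * (x : ℝ)⌋₊ = ⌊((N : ℝ) + 1) * (y : ℝ)⌋₊ := by
      have := congrArg Fin.val hxy
      simpa [c, Fin.ofNat, Nat.mod_eq_of_lt (hlt _)] using this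
    have hx0 : 0 ≤ ((N : ℝ) + 1) * (x : ℝ) := by have := x.2.1; positivity
    have hy0 : 0 ≤ ((N : ℝ) + 1) * (y : ℝ) := by have := y.2.1; positivity
    have h2 := Nat.floor_le hx0
    have h3 := Nat.floor_le hy0
    have h4 := Nat.lt_floor_add_one (((N : ℝ) + 1) * (x : ℝ))
    have h5 := Nat.lt_floor_add_one (((N : ℝ) + 1) * (y : ℝ))
    rw [h1] at h2 h4
    have h6 : ((N : ℝ) + 1) * |(x : ℝ) - y| < 1 := by
      rw [← abs_of_pos (show (0 : ℝ) < N + 1 by positivity), ← abs_mul, abs_lt, mul_sub]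
      constructor <;> linarith
    refine lt_trans ?_ hN
    rw [Subtype.dist_eq, Real.dist_eq, lt_div_iff₀ (by positivity)]
    linarith
  -- Since `φ` preserves measure, `c` and `c ∘ φ` have the same distribution. The resulting `φ ∘ ψ`
  -- keeps almost every point in its cell, moving it by less than `δ`.
  obtain ⟨ψ, hψ, hae⟩ := exists_measurePreserving_comp_ae_eq hc (hc.comp hφ.measurable) fun l => by
    rw [Set.preimage_comp]
    exact (hφ.measure_preimage (hc (measurableSet_singleton l)).nullMeasurableSet).symm
  refine ⟨ψ, hψ, ?_⟩
  have hθ := (hφ.comp hψ).prodMap_unitInterval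
  have hfθ : Integrable fun z : I × I => f (φ (ψ z.1), φ (ψ z.2)) :=
    hθ.integrable_comp_of_integrable hf
  have hgθ : Integrable fun z : I × I => g (φ (ψ z.1), φ (ψ z.2)) :=
    hθ.integrable_comp_of_integrable hgi
  have hi₁ : Integrable fun z : I × I => ‖f z - g z‖ := (hf.sub hgi).norm
  have hi₂ : Integrable fun z : I × I => ‖g z - g (φ (ψ z.1), φ (ψ z.2))‖ := (hgi.sub hgθ).norm
  have hi₃ : Integrable fun z : I × I => ‖f (φ (ψ z.1), φ (ψ z.2)) - g (φ (ψ z.1), φ (ψ z.2))‖ :=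
    (hfθ.sub hgθ).norm
  have hi₁₂ : Integrable fun z : I × I => ‖f z - g z‖ + ‖g z - g (φ (ψ z.1), φ (ψ z.2))‖ := hi₁.add hi₂
  have hae2 : ∀ᵐ z : I × I, ‖g z - g (φ (ψ z.1), φ (ψ z.2))‖ ≤ ε / 3 := by
    have h1 : ∀ᵐ z : I × I, c (φ (ψ z.1)) = c z.1 := Measure.quasiMeasurePreserving_fst.ae hae
    have h2 : ∀ᵐ z : I × I, c (φ (ψ z.2)) = c z.2 := Measure.quasiMeasurePreserving_snd.ae hae
    filter_upwards [h1, h2] with z hz1 hz2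
    rw [← dist_eq_norm]
    refine (hgδ ?_).le
    rw [Prod.dist_eq, max_lt_iff]
    exact ⟨hcd _ _ hz1.symm, hcd _ _ hz2.symm⟩
  have hmid : ∫ z : I × I, ‖g z - g (φ (ψ z.1), φ (ψ z.2))‖ ≤ ε / 3 := by
    calc _ ≤ ∫ _z : I × I, ε / 3 :=
          integral_mono_ae (hgi.sub hgθ).norm (integrable_const _) hae2
      _ = ε / 3 := by simp
  have hlast : ∫ z : I × I, ‖f (φ (ψ z.1), φ (ψ z.2)) - g (φ (ψ z.1), φ (ψ z.2))‖ ≤ ε / 3 := by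
    refine le_trans (le_of_eq ?_) hg
    have := integral_map hθ.measurable.aemeasurable
      (f := fun z => ‖f z - g z‖) (by rw [hθ.map_eq]; exact (hf.sub hgi).norm.aestronglyMeasurable)
    rw [hθ.map_eq] at this
    exact this.symm
  calc ∫ z, ‖f z - f (φ (ψ z.1), φ (ψ z.2))‖
      ≤ ∫ z : I × I, (‖f z - g z‖ + ‖g z - g (φ (ψ z.1), φ (ψ z.2))‖
        + ‖f (φ (ψ z.1), φ (ψ z.2)) - g (φ (ψ z.1), φ (ψ z.2))‖) := by
        refine integral_mono (hf.sub hfθ).norm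
          (hi₁₂.add hi₃) fun z => ?_
        have := norm_add₃_le (a := f z - g z) (b := g z - g (φ (ψ z.1), φ (ψ z.2)))
          (c := -(f (φ (ψ z.1), φ (ψ z.2)) - g (φ (ψ z.1), φ (ψ z.2))))
        rw [norm_neg] at this
        refine le_trans (le_of_eq (congrArg _ ?_)) this
        abel
    _ ≤ ε / 3 + ε / 3 + ε / 3 := by
        rw [integral_add hi₁₂ hi₃, integral_add hi₁ hi₂]
        gcongr
    _ = ε := by ring

namespace DecoratedGraphon

variable {k : ℕ}

lemma cutDelta_pullback_right (W : DecoratedGraphon k) {φ : I → I}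
    (hφ : MeasurePreserving φ volume volume) : cutDelta W (W.pullback φ hφ) = 0 := by
  refine le_antisymm (le_of_forall_pos_le_add fun ε hε => ?_) (cutDelta_nonneg _ _)
  have hint : Integrable fun z : I × I => fun i => W.prob i z :=
    Integrable.of_eval fun i => W.integrable_prob i
  obtain ⟨ψ, hψ, h⟩ := exists_measurePreserving_integral_norm_sub_pullback_le hint hφ
    -- Each of the `k` colours costs at most this much; `k + 1` avoids dividing by zero.
    (show 0 < ε / (k + 1) by positivity)
  have hint' := (hint.sub
    ((hφ.comp hψ).prodMap_unitInterval.integrable_comp_of_integrable hint)).norm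
  refine (cutDelta_le_cutDist_pullback _ _ hψ).trans (cutDist_le_iff.2 ?_)
  refine IsCutBound.of_integral_abs_le
    (fun i => (W.integrable_prob i).sub (integrable_prob _ i)) ?_
  calc ∑ i, ∫ z, |W.prob i z - ((W.pullback φ hφ).pullback ψ hψ).prob i z|
      ≤ ∑ _i : Fin k, ε / (k + 1) := by
        refine Finset.sum_le_sum fun i _ => le_trans (integral_mono
          ((W.integrable_prob i).sub (integrable_prob _ i)).abs hint' fun z => ?_) h
        exact norm_le_pi_norm ((fun i => W.prob i z) - fun i => W.prob i (φ (ψ z.1), φ (ψ z.2))) i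
    _ ≤ 0 + ε := by
        rw [Finset.sum_const, Finset.card_univ, Fintype.card_fin, nsmul_eq_mul, zero_add,
          mul_div_assoc', div_le_iff₀ (by positivity)]
        linarith

lemma cutDelta_pullback_left (W : DecoratedGraphon k) {φ : I → I}
    (hφ : MeasurePreserving φ volume volume) : cutDelta (W.pullback φ hφ) W = 0 :=
  le_antisymm ((cutDelta_le_cutDist_pullback _ _ hφ).trans_eq (cutDist_self _)) (cutDelta_nonneg _ _)

/-- If `U^φ` is near `W`, then so is `U`, because `U` and `U^φ` are at distance zero and `cutDist`
is symmetric. -/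
lemma cutDelta_comm (U W : DecoratedGraphon k) : cutDelta U W = cutDelta W U := by
  have h : ∀ U W : DecoratedGraphon k, cutDelta U W ≤ cutDelta W U := fun U W => by
    refine le_of_forall_pos_lt_add fun ε hε => ?_
    obtain ⟨φ, hφ, h₁⟩ := exists_cutDist_pullback_lt (lt_add_of_pos_right (cutDelta W U) hε)
    have h₂ := cutDelta_triangle U (U.pullback φ hφ) W
    have h₃ := cutDelta_le_cutDist (U.pullback φ hφ) W
    rw [cutDist_comm] at h₃
    rw [cutDelta_pullback_right] at h₂
    linarith
  exact le_antisymm (h U W) (h W U)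

end DecoratedGraphon

/-! ### Weak limits and completeness of the labelled cut distance. -/

open Filter Topology in
/-- Bounded sequences in a Hilbert space converge weakly along every ultrafilter. -/
lemma exists_tendsto_inner_of_norm_le {H : Type*} [NormedAddCommGroup H] [InnerProductSpace ℝ H]
    [CompleteSpace H] (u : Ultrafilter ℕ) {x : ℕ → H} {C : ℝ} (hx : ∀ n, ‖x n‖ ≤ C) :
    ∃ y : H, ∀ z : H, Tendsto (fun n => inner ℝ (x n) z) u (𝓝 (inner ℝ y z)) := by
  let f : ℕ → WeakDual ℝ H := fun n => StrongDual.toWeakDual (InnerProductSpace.toDual ℝ H (x n))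
  -- Banach–Alaoglu, after identifying the space with its dual by Riesz representation.
  obtain ⟨g, -, hg⟩ := (WeakDual.isCompact_closedBall (𝕜 := ℝ) (E := H) 0 C).ultrafilter_le_nhds
    (u.map f) (by
      rw [le_principal_iff, Ultrafilter.mem_coe, Ultrafilter.mem_map]
      refine univ_mem' fun n => ?_
      simpa [f] using hx n)
  refine ⟨(InnerProductSpace.toDual ℝ H).symm (WeakDual.toStrongDual g), fun z => ?_⟩
  rw [InnerProductSpace.toDual_symm_apply]
  exact ((WeakDual.eval_continuous z).tendsto g).comp (show Tendsto f u (𝓝 g) from hg)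

open Filter Topology in
/-- Uniformly bounded sequences of functions converge weakly along every ultrafilter. -/
lemma exists_tendsto_setIntegral_of_abs_le {α : Type*} [MeasurableSpace α] {μ : Measure α}
    [IsFiniteMeasure μ] (u : Ultrafilter ℕ) {f : ℕ → α → ℝ} (hf : ∀ n, Measurable (f n)) {C : ℝ}
    (hC : ∀ n x, |f n x| ≤ C) :
    ∃ g : α → ℝ, Measurable g ∧ Integrable g μ ∧ ∀ A, MeasurableSet A →
      Tendsto (fun n => ∫ x in A, f n x ∂μ) u (𝓝 (∫ x in A, g x ∂μ)) := by
  have hmem : ∀ n, MemLp (f n) 2 μ := fun n =>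
    MemLp.of_bound (hf n).aestronglyMeasurable C (.of_forall (hC n))
  obtain ⟨y, hy⟩ := exists_tendsto_inner_of_norm_le u (x := fun n => (hmem n).toLp)
    fun n => Lp.norm_le_of_ae_bound (abs_nonneg C) (by
      filter_upwards [(hmem n).coeFn_toLp] with x hx
      rw [hx]
      exact (hC n x).trans (le_abs_self C))
  refine ⟨y, (Lp.stronglyMeasurable y).measurable, (Lp.memLp y).integrable one_le_two,
    fun A hA => ?_⟩
  have e : ∀ w : Lp ℝ 2 μ, inner ℝ w (indicatorConstLp 2 hA (measure_ne_top μ A) (1 : ℝ))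
      = ∫ x in A, w x ∂μ := fun w => by
    rw [real_inner_comm, L2.inner_indicatorConstLp_one]
  have h := hy (indicatorConstLp 2 hA (measure_ne_top μ A) (1 : ℝ))
  simp only [e] at h
  refine h.congr fun n => setIntegral_congr_ae hA ?_
  filter_upwards [(hmem n).coeFn_toLp] with x hx _ using hx

namespace DecoratedGraphon

variable {k : ℕ}

/-- The decorated graphon with given colour probabilities. -/
noncomputable def ofProb (v : Fin k → I × I → ℝ) (hm : ∀ i, Measurable (v i))
    (h0 : ∀ i z, 0 ≤ v i z) (h1 : ∀ z, ∑ i, v i z = 1) (hs : ∀ i x y, v i (x, y) = v i (y, x)) :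
    DecoratedGraphon k where
  toFun z := ⟨∑ i, ENNReal.ofReal (v i z) • Measure.dirac i, ⟨by
    simp [← ENNReal.ofReal_sum_of_nonneg fun i _ => h0 i z, h1]⟩⟩
  measurable_toFun := by
    refine Measure.measurable_of_measurable_coe _ fun s _ => ?_
    simp only [ProbabilityMeasure.coe_mk, Measure.coe_finsetSum, Finset.sum_apply,
      Measure.smul_apply, smul_eq_mul]
    exact Finset.measurable_fun_sum _ fun i _ => (hm i).ennreal_ofReal.mul_const _
  symm x y := Subtype.ext (by simp only [hs _ x y])

lemma prob_ofProb {v : Fin k → I × I → ℝ} (hm : ∀ i, Measurable (v i))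
    (h0 : ∀ i z, 0 ≤ v i z) (h1 : ∀ z, ∑ i, v i z = 1) (hs : ∀ i x y, v i (x, y) = v i (y, x))
    (i : Fin k) (z : I × I) : (ofProb v hm h0 h1 hs).prob i z = v i z := by
  simp [prob, ofProb, measureReal_def, Set.indicator_apply, h0]

/-- For `k = 0` there are no graphons at all. Otherwise this supplies the default colour for
`exists_prob_ae_eq`. -/
lemma exists_colour (W : DecoratedGraphon k) : Nonempty (Fin k) := by
  by_contra h
  rw [not_nonempty_iff] at h
  simpa using W.sum_prob (0, 0)

/-- Weak limits satisfy the probability constraints only almost everywhere. The exceptional set is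
symmetric because `v` is, so a point mass at a fixed colour can be used there. -/
lemma exists_prob_ae_eq (hk : Nonempty (Fin k)) {v : Fin k → I × I → ℝ}
    (hm : ∀ i, Measurable (v i)) (h0 : ∀ i, ∀ᵐ z, 0 ≤ v i z) (h1 : ∀ᵐ z, ∑ i, v i z = 1)
    (hs : ∀ i x y, v i (x, y) = v i (y, x)) :
    ∃ V : DecoratedGraphon k, ∀ i, V.prob i =ᵐ[volume] v i := by
  classical
  obtain ⟨i₀⟩ := hk
  let G : Set (I × I) := {z | (∀ i, 0 ≤ v i z) ∧ ∑ i, v i z = 1}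
  have hG : MeasurableSet G := by
    refine MeasurableSet.inter ?_ ?_
    · have : {z : I × I | ∀ i, 0 ≤ v i z} = ⋂ i, {z | 0 ≤ v i z} := by ext; simp
      change MeasurableSet {z : I × I | ∀ i, 0 ≤ v i z}
      rw [this]
      exact MeasurableSet.iInter fun i => measurableSet_le measurable_const (hm i)
    · exact measurableSet_eq_fun (Finset.measurable_fun_sum _ fun i _ => hm i) measurable_const
  have hGs : ∀ x y, (x, y) ∈ G ↔ (y, x) ∈ G := fun x y => by
    simp only [G, Set.mem_ofPred_eq, hs _ x y]
  let w : Fin k → I × I → ℝ := fun i z => if z ∈ G then v i z else if i = i₀ then 1 else 0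
  refine ⟨ofProb w (fun i => Measurable.ite hG (hm i) measurable_const) (fun i z => ?_)
    (fun z => ?_) (fun i x y => ?_), fun i => ?_⟩
  · by_cases hz : z ∈ G
    · simpa [w, hz] using hz.1 i
    · simp only [w, hz, if_false]
      split_ifs <;> norm_num
  · by_cases hz : z ∈ G
    · simpa [w, hz] using hz.2
    · simp [w, hz]
  · simp only [w, hGs x y, hs i x y]
  · filter_upwards [ae_all_iff.2 h0, h1] with z hz hz'
    rw [prob_ofProb]
    have : z ∈ G := ⟨hz, hz'⟩
    simp [w, this]

lemma setIntegral_preimage_swap (f : I × I → ℝ) (A : Set (I × I)) :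
    ∫ z in Prod.swap ⁻¹' A, f z.swap = ∫ z in A, f z :=
  (Measure.measurePreserving_swap (μ := (volume : Measure I))
    (ν := (volume : Measure I))).setIntegral_preimage_emb
    MeasurableEquiv.prodComm.measurableEmbedding f A

open Filter Topology in
/-- The labelled cut distance is complete. -/
lemma exists_cutDist_le_of_cauchy {W : ℕ → DecoratedGraphon k} {b : ℕ → ℝ}
    (h : ∀ n m, n ≤ m → cutDist (W n) (W m) ≤ b n) :
    ∃ V : DecoratedGraphon k, ∀ n, cutDist (W n) V ≤ b n := by
  set u : Ultrafilter ℕ := hyperfilter ℕ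
  choose g hgm hgi hg using fun i => exists_tendsto_setIntegral_of_abs_le
    (μ := (volume : Measure (I × I))) u (f := fun n => (W n).prob i)
    (fun n => (W n).measurable_prob i) (fun n z => (W n).abs_prob_le_one i z)
  -- A weak limit is symmetric only almost everywhere; averaging with the transpose makes it
  -- symmetric at every point without changing the limits of integrals.
  let v : Fin k → I × I → ℝ := fun i z => (g i z + g i z.swap) / 2
  have hvm : ∀ i, Measurable (v i) := fun i =>
    ((hgm i).add ((hgm i).comp measurable_swap)).div_const 2
  have hgsi : ∀ i, Integrable fun z : I × I => g i z.swap := fun i => (hgi i).swap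
  have hvi : ∀ i, Integrable (v i) := fun i => ((hgi i).add (hgsi i)).div_const 2
  have hv : ∀ i A, MeasurableSet A →
      Tendsto (fun n => ∫ z in A, (W n).prob i z) u (𝓝 (∫ z in A, v i z)) := fun i A hA => by
    have e : ∫ z in A, v i z = ((∫ z in A, g i z) + ∫ z in Prod.swap ⁻¹' A, g i z) / 2 := by
      rw [← setIntegral_preimage_swap (g i) (Prod.swap ⁻¹' A), ← Set.preimage_comp,
        Prod.swap_swap_eq, Set.preimage_id, integral_div,
        integral_add (hgi i).integrableOn (hgsi i).integrableOn]
    rw [e]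
    refine (((hg i A hA).add (hg i _ (measurable_swap hA))).div_const 2).congr fun n => ?_
    have e' : ∫ z in Prod.swap ⁻¹' A, (W n).prob i z = ∫ z in A, (W n).prob i z := by
      rw [← setIntegral_preimage_swap]
      exact integral_congr_ae (.of_forall fun z => (W n).prob_swap i z.2 z.1)
    rw [e']
    ring
  have h0 : ∀ i, ∀ᵐ z, 0 ≤ v i z := fun i =>
    ae_nonneg_of_forall_setIntegral_nonneg (hvi i) fun A hA _ =>
      ge_of_tendsto' (hv i A hA) fun n => integral_nonneg fun z => (W n).prob_nonneg i z
  have h1 : ∀ᵐ z, ∑ i, v i z = 1 := by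
    refine Integrable.ae_eq_of_forall_setIntegral_eq _ (fun _ => (1 : ℝ))
      (integrable_finsetSum _ fun i _ => hvi i) (integrable_const 1) fun A hA _ => ?_
    rw [integral_finsetSum _ fun i _ => (hvi i).integrableOn]
    refine tendsto_nhds_unique (tendsto_finsetSum _ fun i _ => hv i A hA) ?_
    refine tendsto_const_nhds.congr fun n => ?_
    rw [← integral_finsetSum _ fun i _ => ((W n).integrable_prob i).integrableOn]
    simp_rw [sum_prob]
  obtain ⟨V, hV⟩ := exists_prob_ae_eq (W 0).exists_colour hvm h0 h1
    fun i x y => by simp only [v, Prod.swap_prod_mk, add_comm]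
  refine ⟨V, fun n => cutDist_le_iff.2 fun S T hS hT => ?_⟩
  -- On a fixed rectangle the cut expression is continuous under weak limits, so the bound `b n`
  -- passes to the limit.
  have key : Tendsto (fun m => ∑ i, |∫ z in S ×ˢ T, ((W n).prob i z - (W m).prob i z)|) u
      (𝓝 (∑ i, |∫ z in S ×ˢ T, ((W n).prob i z - V.prob i z)|)) := by
    refine tendsto_finsetSum _ fun i _ => Tendsto.abs ?_
    have hsub : ∀ Y : DecoratedGraphon k, ∫ z in S ×ˢ T, ((W n).prob i z - Y.prob i z)
        = (∫ z in S ×ˢ T, (W n).prob i z) - ∫ z in S ×ˢ T, Y.prob i z := fun Y =>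
      integral_sub ((W n).integrable_prob i).integrableOn (Y.integrable_prob i).integrableOn
    simp_rw [hsub]
    rw [integral_congr_ae (ae_restrict_of_ae (hV i))]
    exact tendsto_const_nhds.sub (hv i _ (hS.prod hT))
  refine le_of_tendsto key ?_
  have : ∀ᶠ m in (u : Filter ℕ), n ≤ m := Nat.hyperfilter_le_atTop (eventually_ge_atTop n)
  filter_upwards [this] with m hm
  exact cutDist_le_iff.1 (h n m hm) S T hS hT

end DecoratedGraphon

/-! ### Weak regularity and step approximations. -/

/-- Weak regularity by energy decrement: a bounded function on the square is, up to `ε` in the cut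
norm, a signed sum of boundedly many rectangles of height `ε`. -/
lemma exists_sum_rectangles_approx {ε : ℝ} (hε : 0 < ε) (M : ℕ) :
    ∀ {f : I × I → ℝ}, Measurable f → (∃ C, ∀ z, |f z| ≤ C) → ∫ z, f z ^ 2 < M * ε ^ 2 →
    ∃ (s : Fin M → SignType) (S T : Fin M → Set I), (∀ j, MeasurableSet (S j)) ∧
      (∀ j, MeasurableSet (T j)) ∧ ∀ A B : Set I, MeasurableSet A → MeasurableSet B →
        |∫ z in A ×ˢ B, (f z - ∑ j, ε * s j * (S j ×ˢ T j).indicator 1 z)| ≤ ε := by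
  induction M with
  | zero =>
    intro f _ _ h
    have : 0 ≤ ∫ z, f z ^ 2 := integral_nonneg fun z => sq_nonneg _
    simp only [Nat.cast_zero, zero_mul] at h
    linarith
  | succ M ih =>
    intro f hf ⟨C, hC⟩ h
    by_cases hsmall : ∀ A B : Set I, MeasurableSet A → MeasurableSet B →
        |∫ z in A ×ˢ B, f z| ≤ ε
    -- Zero signs pad the sum, so exactly `M` terms are always present.
    · exact ⟨fun _ => 0, fun _ => ∅, fun _ => ∅, fun _ => .empty, fun _ => .empty, by simpa⟩
    push Not at hsmall
    obtain ⟨A, B, hA, hB, hAB⟩ := hsmall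
    set R : Set (I × I) := A ×ˢ B with hR
    have hRm : MeasurableSet R := hA.prod hB
    set t : SignType := SignType.sign (∫ z in R, f z) with ht
    have ht1 : |(t : ℝ)| ≤ 1 := by rcases t <;> simp
    have htf : (t : ℝ) * ∫ z in R, f z = |∫ z in R, f z| := sign_mul_self _
    let f' : I × I → ℝ := fun z => f z - ε * t * R.indicator 1 z
    have hind : ∀ z, |R.indicator (1 : I × I → ℝ) z| ≤ 1 := fun z => by
      by_cases hz : z ∈ R <;> simp [hz]
    have hf' : Measurable f' := hf.sub ((measurable_one.indicator hRm).const_mul _)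
    have hC' : ∀ z, |f' z| ≤ C + ε := fun z => by
      refine (abs_sub _ _).trans (add_le_add (hC z) ?_)
      rw [abs_mul, abs_mul, abs_of_pos hε, mul_assoc]
      exact mul_le_of_le_one_right hε.le (mul_le_one₀ ht1 (abs_nonneg _) (hind z))
    have hint : Integrable f :=
      Integrable.of_bound hf.aestronglyMeasurable C (.of_forall hC)
    have hint2 : Integrable fun z => f z ^ 2 :=
      Integrable.of_bound (hf.pow_const 2).aestronglyMeasurable (C ^ 2) (.of_forall fun z => by
        rw [Real.norm_eq_abs, abs_pow]
        gcongr
        exact hC z)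
    -- Subtracting `ε t 1_R` changes the energy by `-2ε|∫_R f| + ε² t² |R|`, which is below `-2ε² +
    -- ε² = -ε²`.
    have henergy : ∫ z, f' z ^ 2 < M * ε ^ 2 := by
      have e1 : ∀ z, f' z ^ 2 = f z ^ 2 - 2 * ε * t * R.indicator f z
          + ε ^ 2 * (t : ℝ) ^ 2 * R.indicator 1 z := fun z => by
        by_cases hz : z ∈ R <;> simp [f', hz]
        ring
      have e2 : ∫ z, f' z ^ 2 = (∫ z, f z ^ 2) - 2 * ε * (t * ∫ z in R, f z)
          + ε ^ 2 * (t : ℝ) ^ 2 * volume.real R := by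
        have i1 : Integrable fun z => 2 * ε * t * R.indicator f z :=
          (hint.indicator hRm).const_mul _
        have i2 : Integrable fun z => ε ^ 2 * (t : ℝ) ^ 2 * R.indicator (1 : I × I → ℝ) z :=
          ((integrable_const (1 : ℝ)).indicator hRm).const_mul _
        have i3 : Integrable fun z => f z ^ 2 - 2 * ε * t * R.indicator f z := hint2.sub i1
        simp_rw [e1]
        rw [integral_add i3 i2, integral_sub hint2 i1, integral_const_mul, integral_const_mul,
          integral_indicator hRm, integral_indicator_one hRm]
        ring
      rw [e2, htf]
      have h1 : (t : ℝ) ^ 2 * volume.real R ≤ 1 :=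
        mul_le_one₀ ((sq_le_one_iff_abs_le_one _).2 ht1) measureReal_nonneg measureReal_le_one
      push_cast at h
      nlinarith [mul_le_mul_of_nonneg_left h1 (sq_nonneg ε), mul_lt_mul_of_pos_left hAB hε]
    obtain ⟨s, S, T, hS, hT, hst⟩ := ih hf' ⟨_, hC'⟩ henergy
    refine ⟨Fin.cons t s, Fin.cons A S, Fin.cons B T, Fin.cases hA hS, Fin.cases hB hT, ?_⟩
    intro A' B' hA' hB'
    convert hst A' B' hA' hB' using 4 with z
    rw [Fin.sum_univ_succ]
    simp only [Fin.cons_zero, Fin.cons_succ, f', hR]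
    ring

/-- Every decorated graphon is close in the cut distance to a step function, with values from a
finite list of matrices. -/
lemma DecoratedGraphon.exists_step_approx (k : ℕ) {ε : ℝ} (hε : 0 < ε) :
    ∃ (P : Type) (_ : Fintype P) (n : ℕ) (A : P → Fin k → Fin n → Fin n → ℝ) (C : ℝ),
      (∀ p i l m, |A p i l m| ≤ C) ∧ ∀ W : DecoratedGraphon k, ∃ (p : P) (c : I → Fin n),
        Measurable c ∧ IsCutBound (fun i z => W.prob i z - A p i (c z.1) (c z.2)) ε := by
  classical
  set η := ε / (k + 1) with hη
  have hη0 : 0 < η := by positivity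
  -- Each colour has energy at most `1 < M η²`, so one `M` serves all graphons.
  obtain ⟨M, hM⟩ := exists_nat_gt (1 / η ^ 2)
  rw [div_lt_iff₀ (by positivity)] at hM
  -- A label records membership in every `S i j` and `T i j`. The matrix then depends only on the
  -- signs, and it need be neither symmetric nor nonnegative.
  let e := Fintype.equivFin (Fin k → Fin M → Prop × Prop)
  refine ⟨Fin k → Fin M → SignType, inferInstance, _,
    fun s i l m => ∑ j, η * s i j * if (e.symm l i j).1 ∧ (e.symm m i j).2 then 1 else 0,
    M * η, fun s i l m => ?_, fun W => ?_⟩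
  · calc _ ≤ ∑ j, |η * s i j * if (e.symm l i j).1 ∧ (e.symm m i j).2 then 1 else 0| :=
          Finset.abs_sum_le_sum_abs _ _
      _ ≤ ∑ _j : Fin M, η := by
          refine Finset.sum_le_sum fun j _ => ?_
          rw [abs_mul, abs_mul, abs_of_pos hη0, mul_assoc]
          refine mul_le_of_le_one_right hη0.le (mul_le_one₀ ?_ (abs_nonneg _) ?_)
          · rcases s i j <;> simp
          · split_ifs <;> simp
      _ = M * η := by simp
  · choose s S T hS hT hst using fun i => exists_sum_rectangles_approx hη0 M (W.measurable_prob i)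
      ⟨1, W.abs_prob_le_one i⟩ (by
        refine lt_of_le_of_lt ?_ hM
        calc ∫ z, W.prob i z ^ 2 ≤ ∫ _z : I × I, (1 : ℝ) := by
              refine integral_mono_of_nonneg (.of_forall fun z => sq_nonneg _)
                (integrable_const _) (.of_forall fun z => ?_)
              exact (sq_le_one_iff_abs_le_one _).2 (W.abs_prob_le_one i z)
          _ = 1 := by simp)
    let c₀ : I → Fin k → Fin M → Prop × Prop := fun x i j => (x ∈ S i j, x ∈ T i j)
    have hc₀ : Measurable c₀ := measurable_pi_lambda _ fun i => measurable_pi_lambda _ fun j =>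
      (measurable_mem.2 (hS i j)).prodMk (measurable_mem.2 (hT i j))
    refine ⟨s, e ∘ c₀, (measurable_of_countable e).comp hc₀, fun A B hA hB => ?_⟩
    calc _ ≤ ∑ _i : Fin k, η := by
          refine Finset.sum_le_sum fun i _ => ?_
          refine le_of_eq_of_le (congrArg _ (integral_congr_ae (.of_forall fun z => ?_)))
            (hst i A B hA hB)
          simp [c₀, Set.indicator_apply, Set.mem_prod]
      _ ≤ ε := by
          rw [Finset.sum_const, Finset.card_univ, Fintype.card_fin, nsmul_eq_mul, hη,
            mul_div_assoc', div_le_iff₀ (by positivity)]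
          nlinarith

/-! ### Rearranging labellings in increasing order. -/

/-- The quantile function with thresholds `F`. -/
noncomputable def quantileLabel {n : ℕ} (F : Fin (n + 1) → I) (x : I) : Fin (n + 1) :=
  (Finset.univ.filter fun j => F j ≤ x).sup id

lemma le_quantileLabel_iff {n : ℕ} {F : Fin (n + 1) → I} (hF : Monotone F) (hF0 : F 0 = 0)
    {j : Fin (n + 1)} {x : I} : j ≤ quantileLabel F x ↔ F j ≤ x := by
  constructor
  · intro h
    -- The threshold `F 0 = 0` makes the filter nonempty, so its supremum is attained.
    have hne : (Finset.univ.filter fun j => F j ≤ x).Nonempty :=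
      ⟨0, by simp [hF0]⟩
    obtain ⟨m, hm, hm'⟩ := Finset.exists_mem_eq_sup _ hne id
    rw [quantileLabel, hm'] at h
    exact (hF h).trans (Finset.mem_filter.1 hm).2
  · intro h
    exact Finset.le_sup (f := id) (Finset.mem_filter.2 ⟨Finset.mem_univ j, h⟩)

lemma measurable_quantileLabel {n : ℕ} {F : Fin (n + 1) → I} (hF : Monotone F) (hF0 : F 0 = 0) :
    Measurable (quantileLabel F) := by
  refine measurable_of_Ici fun j => ?_
  have : quantileLabel F ⁻¹' Set.Ici j = Set.Ici (F j) := by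
    ext x
    exact le_quantileLabel_iff hF hF0
  rw [this]
  exact measurableSet_Ici

/-- Every labelling can be rearranged into a quantile function. -/
lemma exists_comp_ae_eq_quantileLabel {n : ℕ} {c : I → Fin (n + 1)} (hc : Measurable c)
    {F : Fin (n + 1) → I} (hF : ∀ j, (F j : ℝ) = volume.real {x | c x < j}) :
    ∃ ψ : I → I, MeasurePreserving ψ volume volume ∧ ∀ᵐ x, c (ψ x) = quantileLabel F x := by
  have hmono : Monotone F := fun i j hij => by
    rw [← Subtype.coe_le_coe, hF, hF]
    exact measureReal_mono fun x hx => lt_of_lt_of_le hx hij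
  have hF0 : F 0 = 0 := Subtype.ext (by rw [hF]; simp)
  have hq := measurable_quantileLabel hmono hF0
  have hlaw : (volume : Measure I).map (quantileLabel F) = (volume : Measure I).map c := by
    have := Measure.isProbabilityMeasure_map (μ := (volume : Measure I)) hq.aemeasurable
    refine Measure.ext_of_Ici _ _ fun j => ?_
    rw [Measure.map_apply hq measurableSet_Ici, Measure.map_apply hc measurableSet_Ici]
    have h1 : quantileLabel F ⁻¹' Set.Ici j = Set.Ici (F j) := by
      ext x
      exact le_quantileLabel_iff hmono hF0
    have h2 : c ⁻¹' Set.Ici j = {x | c x < j}ᶜ := by ext x; simp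
    have hm : MeasurableSet {x | c x < j} := hc measurableSet_Iio
    rw [h1, h2, unitInterval.volume_Ici, hF, ← probReal_compl_eq_one_sub hm, ofReal_measureReal]
  refine exists_measurePreserving_comp_ae_eq hq hc fun l => ?_
  rw [← Measure.map_apply hq (measurableSet_singleton l), hlaw,
    Measure.map_apply hc (measurableSet_singleton l)]

/-- After both labellings are sorted, they can differ at `x` only if `x` lies between the two
thresholds of some label `j`, an interval of length the `j`-th summand. -/
lemma exists_measurePreserving_measureReal_ne_le {n : ℕ} {c c' : I → Fin (n + 1)}
    (hc : Measurable c) (hc' : Measurable c') :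
    ∃ ψ ψ' : I → I, MeasurePreserving ψ volume volume ∧ MeasurePreserving ψ' volume volume ∧
      volume.real {x | c (ψ x) ≠ c' (ψ' x)} ≤
        ∑ j, |volume.real {x | c x < j} - volume.real {x | c' x < j}| := by
  let F : Fin (n + 1) → I := fun j =>
    ⟨volume.real {x | c x < j}, measureReal_nonneg, measureReal_le_one⟩
  let F' : Fin (n + 1) → I := fun j =>
    ⟨volume.real {x | c' x < j}, measureReal_nonneg, measureReal_le_one⟩
  obtain ⟨ψ, hψ, h⟩ := exists_comp_ae_eq_quantileLabel hc (F := F) fun j => rfl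
  obtain ⟨ψ', hψ', h'⟩ := exists_comp_ae_eq_quantileLabel hc' (F := F') fun j => rfl
  refine ⟨ψ, ψ', hψ, hψ', ?_⟩
  have hsub : {x | quantileLabel F x ≠ quantileLabel F' x} ⊆ ⋃ j, Set.uIcc (F j) (F' j) := by
    intro x hx
    by_contra hcon
    refine hx ?_
    have : ∀ j, F j ≤ x ↔ F' j ≤ x := fun j => by
      have hj : x ∉ Set.uIcc (F j) (F' j) := fun hj => hcon (Set.mem_iUnion.2 ⟨j, hj⟩)
      rw [Set.mem_uIcc] at hj
      push Not at hj
      exact ⟨fun h1 => (hj.1 h1).le, fun h1 => (hj.2 h1).le⟩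
    simp [quantileLabel, this]
  calc volume.real {x | c (ψ x) ≠ c' (ψ' x)}
      = volume.real {x | quantileLabel F x ≠ quantileLabel F' x} := by
        refine measureReal_congr ?_
        filter_upwards [h, h'] with x hx hx'
        exact propext (by change (c (ψ x) ≠ c' (ψ' x)) ↔ _; rw [hx, hx']; rfl)
    _ ≤ volume.real (⋃ j, Set.uIcc (F j) (F' j)) := measureReal_mono hsub
    _ ≤ ∑ j, volume.real (Set.uIcc (F j) (F' j)) := measureReal_iUnion_fintype_le _
    _ = _ := Finset.sum_congr rfl fun j _ => by
        rw [measureReal_def, unitInterval.volume_uIcc, edist_dist,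
          ENNReal.toReal_ofReal dist_nonneg, dist_comm, Subtype.dist_eq, Real.dist_eq]

/-- The integrand is at most `2C` and vanishes unless a coordinate lies in `D`, a pair of strips of
total area at most `2|D|`. -/
lemma isCutBound_step_sub_step {k n : ℕ} {A : Fin k → Fin n → Fin n → ℝ} {C : ℝ}
    (hA : ∀ i l m, |A i l m| ≤ C) {c c' : I → Fin n} (hc : Measurable c) (hc' : Measurable c') :
    IsCutBound (fun i z => A i (c z.1) (c z.2) - A i (c' z.1) (c' z.2))
      (k * (4 * C * volume.real {x | c x ≠ c' x})) := by
  set D : Set I := {x | c x ≠ c' x} with hD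
  have hDm : MeasurableSet D := (measurableSet_eq_fun hc hc').compl
  have hm : ∀ i, ∀ {d : I → Fin n}, Measurable d →
      Measurable fun z : I × I => A i (d z.1) (d z.2) := fun i d hd =>
    (measurable_of_countable fun p : Fin n × Fin n => A i p.1 p.2).comp
      ((hd.comp measurable_fst).prodMk (hd.comp measurable_snd))
  have hint : ∀ i, Integrable fun z : I × I => A i (c z.1) (c z.2) - A i (c' z.1) (c' z.2) :=
    fun i => (Integrable.of_bound (hm i hc).aestronglyMeasurable C
      (.of_forall fun z => hA _ _ _)).sub (Integrable.of_bound (hm i hc').aestronglyMeasurable C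
      (.of_forall fun z => hA _ _ _))
  refine IsCutBound.of_integral_abs_le hint ?_
  have hi : Integrable (D.indicator (fun _ => (1 : ℝ))) :=
    (integrable_const (1 : ℝ)).indicator hDm
  have hi₁ : Integrable fun z : I × I => D.indicator (fun _ => (1 : ℝ)) z.1 := hi.comp_fst _
  have hi₂ : Integrable fun z : I × I => D.indicator (fun _ => (1 : ℝ)) z.2 := hi.comp_snd _
  have hval : ∫ x, D.indicator (fun _ => (1 : ℝ)) x = volume.real D := by
    rw [integral_indicator hDm]; simp
  calc _ ≤ ∑ _i : Fin k, 4 * C * volume.real D := by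
        refine Finset.sum_le_sum fun i _ => ?_
        calc _ ≤ ∫ z : I × I, 2 * C *
              (D.indicator (fun _ => (1 : ℝ)) z.1 + D.indicator (fun _ => (1 : ℝ)) z.2) := by
              refine integral_mono (hint i).abs ((hi₁.add hi₂).const_mul _) fun z => ?_
              have hC0 : 0 ≤ C := (abs_nonneg _).trans (hA i (c z.1) (c z.1))
              have hle : |A i (c z.1) (c z.2) - A i (c' z.1) (c' z.2)| ≤ 2 * C :=
                (abs_sub _ _).trans (by linarith [hA i (c z.1) (c z.2), hA i (c' z.1) (c' z.2)])
              by_cases h1 : c z.1 = c' z.1 <;> by_cases h2 : c z.2 = c' z.2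
              · simp [hD, h1, h2]
              · simpa [hD, h1, h2] using hle
              · simpa [hD, h1, h2] using hle
              · simp only [hD, Set.indicator_apply, Set.mem_ofPred_eq, ne_eq, h1, h2,
                  not_false_eq_true, if_true]
                linarith
          _ = 4 * C * volume.real D := by
              rw [integral_const_mul, integral_add hi₁ hi₂,
                Measure.volume_eq_prod, integral_fun_fst, integral_fun_snd, hval]
              simp
              ring
    _ = _ := by simp

/-! ### Total boundedness. -/

namespace DecoratedGraphon

/-- The code is the matrix index together with the cumulative class sizes rounded to multiples of `1
/ N`. Equal codes give the same matrix and labellings that, once sorted, differ on measure at most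
`(n + 1) / N`; the two approximations and this discrepancy cost at most `ε / 4` each. -/
lemma exists_finite_discretization (k : ℕ) {ε : ℝ} (hε : 0 < ε) :
    ∃ (β : Type) (_ : Fintype β) (code : DecoratedGraphon k → β),
      ∀ U W, code U = code W → cutDelta U W < ε := by
  obtain ⟨P, hP, n, A, C, hA, happ⟩ := exists_step_approx k (show 0 < ε / 4 by positivity)
  rcases isEmpty_or_nonempty (DecoratedGraphon k) with hemp | ⟨⟨W₀⟩⟩
  · exact ⟨Unit, inferInstance, fun _ => (), fun U => (hemp.false U).elim⟩
  obtain ⟨n, rfl⟩ : ∃ m, n = m + 1 := by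
    obtain ⟨-, c, -⟩ := happ W₀
    exact Nat.exists_eq_succ_of_ne_zero fun h => by subst h; exact (c 0).elim0
  choose p c hc hcut using happ
  -- Chosen so that a discrepancy of measure `(n + 1) / N` costs less than `ε / 4` in
  -- `isCutBound_step_sub_step`.
  obtain ⟨N, hN⟩ := exists_nat_gt (k * (4 * |C| * (n + 1)) / (ε / 4))
  rw [div_lt_iff₀ (by positivity)] at hN
  have hN0 : (0 : ℝ) < N := by
    by_contra h
    have : (N : ℝ) * (ε / 4) ≤ 0 := mul_nonpos_of_nonpos_of_nonneg (not_lt.1 h) (by positivity)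
    have : 0 ≤ (k : ℝ) * (4 * |C| * (n + 1)) := by positivity
    linarith
  let Φ : DecoratedGraphon k → Fin (n + 1) → ℝ := fun W j => volume.real {x | c W x < j}
  have hfl : ∀ W j, ⌊N * Φ W j⌋₊ < N + 1 := fun W j => by
    rw [Nat.floor_lt (mul_nonneg hN0.le measureReal_nonneg)]
    have : Φ W j ≤ 1 := measureReal_le_one
    push_cast
    nlinarith
  refine ⟨P × (Fin (n + 1) → Fin (N + 1)), inferInstance,
    fun W => (p W, fun j => ⟨⌊N * Φ W j⌋₊, hfl W j⟩), fun U W h => ?_⟩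
  rw [Prod.mk.injEq] at h
  obtain ⟨hp, hΦ⟩ := h
  have hclose : ∀ j, |Φ U j - Φ W j| ≤ 1 / N := fun j => by
    have e : ⌊N * Φ U j⌋₊ = ⌊N * Φ W j⌋₊ := congrArg Fin.val (congrFun hΦ j)
    have hU : 0 ≤ N * Φ U j := mul_nonneg hN0.le measureReal_nonneg
    have hW : 0 ≤ N * Φ W j := mul_nonneg hN0.le measureReal_nonneg
    have h1 := Nat.floor_le hU
    have h2 := Nat.lt_floor_add_one (N * Φ U j)
    have h3 := Nat.floor_le hW
    have h4 := Nat.lt_floor_add_one (N * Φ W j)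
    rw [e] at h1 h2
    rw [le_div_iff₀ hN0, ← abs_of_pos hN0, ← abs_mul, abs_le, sub_mul]
    constructor <;> linarith
  obtain ⟨ψ, ψ', hψ, hψ', hne⟩ := exists_measurePreserving_measureReal_ne_le (hc U) (hc W)
  have hne' : volume.real {x | c U (ψ x) ≠ c W (ψ' x)} ≤ (n + 1) / N := by
    refine hne.trans ((Finset.sum_le_sum fun j _ => hclose j).trans_eq ?_)
    simp [div_eq_mul_inv]
  have hmA : ∀ q i, ∀ {d : I → Fin (n + 1)}, Measurable d →
      Measurable fun z : I × I => A q i (d z.1) (d z.2) := fun q i d hd =>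
    (measurable_of_countable fun r : Fin (n + 1) × Fin (n + 1) => A q i r.1 r.2).comp
      ((hd.comp measurable_fst).prodMk (hd.comp measurable_snd))
  have hpull : ∀ (Y : DecoratedGraphon k) {θ : I → I} (hθ : MeasurePreserving θ volume volume),
      IsCutBound (fun i z => (Y.pullback θ hθ).prob i z
        - A (p Y) i (c Y (θ z.1)) (c Y (θ z.2))) (ε / 4) := fun Y θ hθ =>
    (hcut Y).comp (C := 1 + C) (fun i => (Y.measurable_prob i).sub (hmA _ i (hc Y)))
      (fun i z => (abs_sub _ _).trans (add_le_add (Y.abs_prob_le_one i z) (hA _ _ _ _))) hθ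
  have hintA : ∀ q i, ∀ {d : I → Fin (n + 1)}, Measurable d →
      Integrable fun z : I × I => A q i (d z.1) (d z.2) := fun q i d hd =>
    Integrable.of_bound (hmA q i hd).aestronglyMeasurable C (.of_forall fun z => hA _ _ _ _)
  have hcU : Measurable fun x => c U (ψ x) := (hc U).comp hψ.measurable
  have hcW : Measurable fun x => c W (ψ' x) := (hc W).comp hψ'.measurable
  have hstep := isCutBound_step_sub_step (fun i l m => (hA (p W) i l m).trans (le_abs_self C))
    hcU hcW
  have hbound : (k : ℝ) * (4 * |C| * volume.real {x | c U (ψ x) ≠ c W (ψ' x)}) ≤ ε / 4 := by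
    calc _ ≤ (k : ℝ) * (4 * |C| * ((n + 1) / N)) := by gcongr
      _ = k * (4 * |C| * (n + 1)) / N := by ring
      _ ≤ ε / 4 := by rw [div_le_iff₀ hN0]; linarith
  have hU := hpull U hψ
  rw [hp] at hU
  have h1 := hU.add (fun i => (integrable_prob _ i).sub (hintA _ i hcU))
    (fun i => (hintA _ i hcU).sub (hintA _ i hcW)) hstep
  have h2 := h1.add (fun i => ((integrable_prob _ i).sub (hintA _ i hcU)).add
      ((hintA _ i hcU).sub (hintA _ i hcW)))
    (fun i => ((integrable_prob _ i).sub (hintA _ i hcW)).neg) (hpull W hψ').neg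
  have h3 : cutDist (U.pullback ψ hψ) (W.pullback ψ' hψ') ≤
      ε / 4 + (k : ℝ) * (4 * |C| * volume.real {x | c U (ψ x) ≠ c W (ψ' x)}) + ε / 4 := by
    refine cutDist_le_iff.2 ?_
    convert h2 using 3 with i z
    simp only [Pi.add_apply, Pi.sub_apply, Pi.neg_apply]
    ring
  have t1 := cutDelta_triangle U (U.pullback ψ hψ) W
  have t2 := cutDelta_triangle (U.pullback ψ hψ) (W.pullback ψ' hψ') W
  have t3 := cutDelta_le_cutDist (U.pullback ψ hψ) (W.pullback ψ' hψ')
  rw [cutDelta_pullback_right] at t1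
  rw [cutDelta_pullback_left] at t2
  linarith

end DecoratedGraphon

/-! ### The quotient metric, completeness and compactness. -/

namespace DecoratedGraphon

variable {k : ℕ}

lemma equivalence_cutEquiv : Equivalence (CutEquiv (k := k)) where
  refl := cutDelta_self
  symm {U W} h := by rw [CutEquiv, cutDelta_comm]; exact h
  trans {U V W} h h' := by
    refine le_antisymm ((cutDelta_triangle U V W).trans_eq ?_) (cutDelta_nonneg _ _)
    rw [show cutDelta U V = 0 from h, show cutDelta V W = 0 from h', add_zero]

lemma cutDelta_congr {U U' W W' : DecoratedGraphon k} (h : CutEquiv U U') (h' : CutEquiv W W') :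
    cutDelta U W = cutDelta U' W' := by
  have key : ∀ {U U' W W' : DecoratedGraphon k}, CutEquiv U U' → CutEquiv W W' →
      cutDelta U W ≤ cutDelta U' W' := fun {U U' W W'} h h' => by
    have h1 := cutDelta_triangle U U' W
    have h2 := cutDelta_triangle U' W' W
    rw [show cutDelta U U' = 0 from h] at h1
    rw [show cutDelta W' W = 0 from equivalence_cutEquiv.symm h'] at h2
    linarith
  exact le_antisymm (key h h') (key (equivalence_cutEquiv.symm h) (equivalence_cutEquiv.symm h'))

open Filter Topology in
/-- The cut distance is complete. -/
lemma exists_tendsto_cutDelta {W : ℕ → DecoratedGraphon k}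
    (h : ∀ n, cutDelta (W n) (W (n + 1)) < (1 / 2) ^ n) :
    ∃ V : DecoratedGraphon k, Tendsto (fun n => cutDelta (W n) V) atTop (𝓝 0) := by
  choose φ hφ hlt using fun n => exists_cutDist_pullback_lt (h n)
  -- Composing the successive near-optimal maps aligns all terms: `X (n + 1)` is `W (n + 1)` pulled
  -- back by `φ n` and then by the same `Φ n` that defines `X n`.
  let Φ : ℕ → {φ : I → I // MeasurePreserving φ volume volume} :=
    Nat.rec ⟨id, MeasurePreserving.id volume⟩ fun n θ => ⟨φ n ∘ θ.1, (hφ n).comp θ.2⟩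
  let X : ℕ → DecoratedGraphon k := fun n => (W n).pullback (Φ n).1 (Φ n).2
  have hX : ∀ n, cutDist (X n) (X (n + 1)) ≤ (1 / 2) ^ n := fun n =>
    (cutDist_pullback_le (W n) ((W (n + 1)).pullback (φ n) (hφ n)) (Φ n).2).trans (hlt n).le
  have hX' : ∀ n m, n ≤ m → cutDist (X n) (X m) ≤ 2 * (1 / 2) ^ n := fun n m hnm => by
    -- The exact geometric sum, subtracted term included, is what lets the induction close.
    have : cutDist (X n) (X m) ≤ 2 * (1 / 2) ^ n - 2 * (1 / 2) ^ m := by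
      induction m, hnm using Nat.le_induction with
      | base => rw [cutDist_self, sub_self]
      | succ m _ ih =>
        have h1 := cutDist_triangle (X n) (X m) (X (m + 1))
        have h2 := hX m
        rw [pow_succ]
        linarith
    have h3 : (0 : ℝ) ≤ 2 * (1 / 2) ^ m := by positivity
    linarith
  obtain ⟨V, hV⟩ := exists_cutDist_le_of_cauchy hX'
  refine ⟨V, squeeze_zero (fun n => cutDelta_nonneg _ _) (g := fun n => 2 * (1 / 2 : ℝ) ^ n)
    (fun n => ?_) ?_⟩
  · have h1 := cutDelta_triangle (W n) (X n) V
    rw [cutDelta_pullback_right, zero_add] at h1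
    exact h1.trans ((cutDelta_le_cutDist _ _).trans (hV n))
  · simpa using (tendsto_pow_atTop_nhds_zero_of_lt_one (by norm_num : (0 : ℝ) ≤ 1 / 2)
      (by norm_num)).const_mul 2

/-- The metric induced by the cut distance on the quotient. -/
noncomputable abbrev cutMetricSpace (k : ℕ) :
    MetricSpace (Quotient (Setoid.mk (CutEquiv (k := k)) equivalence_cutEquiv)) where
  dist := Quotient.lift₂ cutDelta fun _ _ _ _ h h' => cutDelta_congr h h'
  dist_self := by rintro ⟨U⟩; exact cutDelta_self U
  dist_comm := by rintro ⟨U⟩ ⟨W⟩; exact cutDelta_comm U W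
  dist_triangle := by rintro ⟨U⟩ ⟨V⟩ ⟨W⟩; exact cutDelta_triangle U V W
  eq_of_dist_eq_zero := by rintro ⟨U⟩ ⟨W⟩ h; exact Quotient.sound h

open Filter Topology in
lemma compactSpace_cutMetricSpace (k : ℕ) :
    @CompactSpace (Quotient (Setoid.mk (CutEquiv (k := k)) equivalence_cutEquiv))
      (cutMetricSpace k).toUniformSpace.toTopologicalSpace := by
  let _ := cutMetricSpace k
  have hdist : ∀ a b : Quotient (Setoid.mk (CutEquiv (k := k)) equivalence_cutEquiv),
      dist a b = cutDelta a.out b.out := fun a b => by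
    conv_lhs => rw [← Quotient.out_eq a, ← Quotient.out_eq b]
    rfl
  rw [← isCompact_univ_iff, isCompact_iff_totallyBounded_isComplete,
    ← completeSpace_iff_isComplete_univ]
  constructor
  · refine Metric.totallyBounded_of_finite_discretization fun ε hε => ?_
    obtain ⟨β, hβ, code, hcode⟩ := exists_finite_discretization k hε
    exact ⟨β, hβ, fun x => code x.1.out, fun x y hxy => by rw [hdist]; exact hcode _ _ hxy⟩
  · refine Metric.complete_of_convergent_controlled_sequences (fun n => (1 / 2) ^ n)
      (fun n => by positivity) fun a ha => ?_
    obtain ⟨V, hV⟩ := exists_tendsto_cutDelta (W := fun n => (a n).out) fun n => by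
      rw [← hdist]
      exact ha n n (n + 1) le_rfl n.le_succ
    refine ⟨Quotient.mk _ V, tendsto_iff_dist_tendsto_zero.2 (hV.congr fun n => ?_)⟩
    conv_rhs => rw [← Quotient.out_eq (a n)]
    rfl

end DecoratedGraphon

theorem mainTheorem9 (k : ℕ) :
    ∃ (h : Equivalence (DecoratedGraphon.CutEquiv (k := k)))
      (m : MetricSpace (Quotient (Setoid.mk DecoratedGraphon.CutEquiv h))),
      (∀ U W : DecoratedGraphon k,
        m.dist (Quotient.mk _ U) (Quotient.mk _ W) = DecoratedGraphon.cutDelta U W) ∧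
      @CompactSpace (Quotient (Setoid.mk DecoratedGraphon.CutEquiv h))
        m.toUniformSpace.toTopologicalSpace :=
  ⟨DecoratedGraphon.equivalence_cutEquiv, DecoratedGraphon.cutMetricSpace k, fun _ _ => rfl,
    DecoratedGraphon.compactSpace_cutMetricSpace k⟩
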